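/- Let $1\le p<\infty$, let $\sigma_1\ge\sigma_2\ge\dots>0$ with $\sum_{j}\sigma_j^p<\infty$, and let $\mu=\bigotimes_{j\in\mathbb N}\mathcal N(0,\sigma_j^2)$ be the corresponding non-degenerate centred diagonal Gaussian measure on $\ell^p=\ell^p(\mathbb N)$. Put $$\alpha=\min(p,2),\qquad q=\max\bigl(p,\,2(p-1)^2\bigr),\qquad S=\Bigl(\sum_{j\in\mathbb N}\sigma_j^p\Bigr)^{1/p},$$ let $P_k z=(z_{k+1},z_{k+2},\dots)$ for $k\in\mathbb N\cup\{0\}$, and let $B_\delta(x)$ be the open ball of radius $\delta$ around $x$ in $\ell^p$. Then for all $0<\delta<1$, all $k\in\mathbb N\cup\{0\}$, all $\gamma>0$ and all $z\in\ell^p$ we have $\mu(B_\delta(0))>0$ and $$\frac{\mu(B_\delta(z))}{\mu(B_\delta(0))}\;\le\;\exp\Bigl(-\frac{\gamma^{2-\alpha}}{4q\,\sigma_{k+1}^{\alpha}}\Bigl(\bigl|\,\|P_kz\|_p-\delta\,\bigr|^{\alpha}-\gamma^{\alpha}S^{\alpha}-\delta^{\alpha}\Bigr)\Bigr).$$ 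-/

import Mathlib

open MeasureTheory ProbabilityTheory
open scoped ENNReal NNReal

noncomputable section

/-- The real sequence space `ℓ^p = ℓ^p(ℕ)`. Coordinates are indexed from `0`, so the coordinate
`x_{j+1}` of the usual one-based indexing is `x j`. -/
abbrev SeqSpace (p : ℝ≥0∞) : Type := lp (fun _ : ℕ => ℝ) p

/-- `ℓ^p` carries its Borel σ-algebra. -/
instance SeqSpace.instMeasurableSpace (p : ℝ≥0∞) [Fact (1 ≤ p)] : MeasurableSpace (SeqSpace p) :=
  borel (SeqSpace p)

instance SeqSpace.instBorelSpace (p : ℝ≥0∞) [Fact (1 ≤ p)] : BorelSpace (SeqSpace p) := ⟨rfl⟩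

/-- The inclusion of `ℓ^p` into the space `ℝ^ℕ` of all real sequences. -/
def SeqSpace.incl (p : ℝ≥0∞) (x : SeqSpace p) : ℕ → ℝ := fun j => x j

/-- The product measure `⊗_j N(0, σ_j²)` on `ℝ^ℕ`. -/
def gaussianProduct (σ : ℕ → ℝ) : Measure (ℕ → ℝ) :=
  Measure.infinitePi (fun j => gaussianReal 0 (Real.toNNReal (σ j ^ 2)))

/-- The diagonal Gaussian measure `μ = ⊗_j N(0, σ_j²)` on `ℓ^p`: the product measure on `ℝ^ℕ`
restricted to the subspace `ℓ^p`, that is, `μ A` is the product measure of `A ⊆ ℓ^p ⊆ ℝ^ℕ`.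
See `diagonalGaussian_apply` and `map_incl_diagonalGaussian`. -/
def diagonalGaussian (p : ℝ≥0∞) [Fact (1 ≤ p)] (σ : ℕ → ℝ) : Measure (SeqSpace p) :=
  (gaussianProduct σ).comap (SeqSpace.incl p)

/-- The tail operator `P_k`, `(x_1, x_2, …) ↦ (x_{k+1}, x_{k+2}, …)`, on `ℓ^p`. -/
def SeqSpace.tail {p : ℝ≥0∞} [Fact (1 ≤ p)] (k : ℕ) (x : SeqSpace p) : SeqSpace p :=
  ⟨fun j => x (k + j), by
    have hx : Memℓp (fun j => x j) p := lp.memℓp x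
    have hinj : Function.Injective (fun j : ℕ => k + j) := fun a b h => by simpa using h
    have h1 : (1 : ℝ≥0∞) ≤ p := Fact.out
    show Memℓp (fun j => x (k + j)) p
    rcases eq_or_ne p ∞ with hp | hp
    · subst hp
      obtain ⟨C, hC⟩ := memℓp_infty_iff.1 hx
      refine memℓp_infty ⟨C, ?_⟩
      rintro _ ⟨j, rfl⟩
      exact hC ⟨k + j, rfl⟩
    · have h0 : 0 < p.toReal := ENNReal.toReal_pos (zero_lt_one.trans_le h1).ne' hp
      exact memℓp_gen ((hx.summable h0).comp_injective hinj)⟩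

/-- The ratio `ν(B_δ(w)) / ν(B_δ(z))` of the masses of two open balls. -/
def ballRatio {X : Type*} [PseudoMetricSpace X] [MeasurableSpace X] (ν : Measure X)
    (w z : X) (δ : ℝ) : ℝ :=
  ν.real (Metric.ball w δ) / ν.real (Metric.ball z δ)

/-- `α = min(p, 2)`. -/
def expAlpha (p : ℝ≥0∞) : ℝ := min p.toReal 2

/-- `q = max(p, 2 (p - 1)²)`. -/
def constQ (p : ℝ≥0∞) : ℝ := max p.toReal (2 * (p.toReal - 1) ^ 2)

/-- `S = (∑_j σ_j^p)^{1/p}`. -/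
def constS (p : ℝ≥0∞) (σ : ℕ → ℝ) : ℝ := (∑' j, σ j ^ p.toReal) ^ (1 / p.toReal)

/-! The definition of `diagonalGaussian` has no junk values: the inclusion is a measurable
embedding, and the product measure is concentrated on `ℓ^p` when `∑_j σ_j^p < ∞`. -/

theorem SeqSpace.secondCountable (p : ℝ≥0∞) [Fact (1 ≤ p)] (hp : p ≠ ∞) :
    SecondCountableTopology (SeqSpace p) := by
  have hsep : TopologicalSpace.IsSeparable
      (Submodule.span ℝ (Set.range fun i : ℕ =>
        (lp.single p i (1 : ℝ) : SeqSpace p)) : Set (SeqSpace p)) :=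
    (Set.countable_range _).isSeparable.span
  have hcl := hsep.closure
  have huniv : closure (Submodule.span ℝ (Set.range fun i : ℕ =>
      (lp.single p i (1 : ℝ) : SeqSpace p)) : Set (SeqSpace p)) = Set.univ := by
    refine Set.eq_univ_of_forall fun f => ?_
    refine mem_closure_of_tendsto (lp.hasSum_single hp f) (Filter.Eventually.of_forall fun s => ?_)
    refine Submodule.sum_mem _ fun i _ => ?_
    have : (lp.single p i (f i) : SeqSpace p) = f i • (lp.single p i (1 : ℝ) : SeqSpace p) := by
      rw [← lp.single_smul]; simp
    rw [this]
    exact Submodule.smul_mem _ _ (Submodule.subset_span ⟨i, rfl⟩)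
  rw [huniv] at hcl
  have : TopologicalSpace.SeparableSpace (SeqSpace p) :=
    TopologicalSpace.isSeparable_univ_iff.1 hcl
  exact UniformSpace.secondCountable_of_separable _

theorem SeqSpace.measurableEmbedding_incl (p : ℝ≥0∞) [Fact (1 ≤ p)] (hp : p ≠ ∞) :
    MeasurableEmbedding (SeqSpace.incl p) := by
  have := SeqSpace.secondCountable p hp
  have h0 : p ≠ 0 := (zero_lt_one.trans_le (Fact.out : (1 : ℝ≥0∞) ≤ p)).ne'
  have hm : Measurable (SeqSpace.incl p) := by
    refine measurable_pi_lambda _ fun j => Continuous.measurable ?_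
    refine (LipschitzWith.of_dist_le_mul (K := 1) fun x y => ?_).continuous
    have := lp.norm_apply_le_norm h0 (x - y) j
    simpa [SeqSpace.incl, dist_eq_norm] using this
  refine hm.measurableEmbedding fun x y h => ?_
  ext j
  exact congrFun h j

theorem diagonalGaussian_apply (p : ℝ≥0∞) [Fact (1 ≤ p)] (hp : p ≠ ∞) (σ : ℕ → ℝ)
    (A : Set (SeqSpace p)) :
    diagonalGaussian p σ A = gaussianProduct σ (SeqSpace.incl p '' A) :=
  (SeqSpace.measurableEmbedding_incl p hp).comap_apply _ _

theorem map_incl_diagonalGaussian (p : ℝ≥0∞) [Fact (1 ≤ p)] (hp : p ≠ ∞) (σ : ℕ → ℝ)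
    (hpos : ∀ j, 0 < σ j) (hsum : Summable fun j => σ j ^ p.toReal) :
    (diagonalGaussian p σ).map (SeqSpace.incl p) = gaussianProduct σ := by
  have h0 : p ≠ 0 := (zero_lt_one.trans_le (Fact.out : (1 : ℝ≥0∞) ≤ p)).ne'
  have hp0 : 0 < p.toReal := ENNReal.toReal_pos h0 hp
  have hmeas : ∀ j : ℕ, Measurable fun x : ℕ → ℝ => ‖x j‖ₑ ^ p.toReal := fun j =>
    (measurable_pi_apply j).enorm.pow_const _
  have hmom : ∀ j : ℕ, ∫⁻ x, ‖x j‖ₑ ^ p.toReal ∂(gaussianProduct σ)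
      = ENNReal.ofReal (σ j ^ p.toReal) * ∫⁻ t, ‖t‖ₑ ^ p.toReal ∂(gaussianReal 0 1) := by
    intro j
    have hmt : Measurable fun t : ℝ => ‖t‖ₑ ^ p.toReal := measurable_enorm.pow_const _
    have hmap : (gaussianProduct σ).map (fun x => x j)
        = (gaussianReal 0 1).map (fun t => σ j * t) := by
      have hv : NNReal.mk (σ j ^ 2) (sq_nonneg (σ j)) = Real.toNNReal (σ j ^ 2) :=
        (Real.toNNReal_of_nonneg (sq_nonneg (σ j))).symm
      rw [gaussianReal_map_const_mul, hv, mul_zero, mul_one]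
      have := (measurePreserving_eval_infinitePi
        (fun j => gaussianReal 0 (Real.toNNReal (σ j ^ 2))) j).map_eq
      exact this
    rw [← lintegral_map (f := fun t : ℝ => ‖t‖ₑ ^ p.toReal) hmt (measurable_pi_apply j), hmap,
      lintegral_map hmt (measurable_const_mul _), ← lintegral_const_mul _ hmt]
    refine lintegral_congr fun t => ?_
    rw [enorm_mul, ENNReal.mul_rpow_of_nonneg _ _ hp0.le, Real.enorm_of_nonneg (hpos j).le,
      ENNReal.ofReal_rpow_of_pos (hpos j)]
  have hfin : ∫⁻ t, ‖t‖ₑ ^ p.toReal ∂(gaussianReal 0 1) < ∞ := by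
    have := (memLp_id_gaussianReal' (μ := 0) (v := 1) p hp).2
    exact (eLpNorm_lt_top_iff_lintegral_rpow_enorm_lt_top h0 hp).1 this
  have htot : ∫⁻ x, ∑' j, ‖x j‖ₑ ^ p.toReal ∂(gaussianProduct σ) ≠ ∞ := by
    rw [lintegral_tsum fun j => (hmeas j).aemeasurable]
    simp_rw [hmom]
    rw [ENNReal.tsum_mul_right]
    exact ENNReal.mul_ne_top hsum.tsum_ofReal_ne_top hfin.ne
  have hae : ∀ᵐ x ∂(gaussianProduct σ), x ∈ Set.range (SeqSpace.incl p) := by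
    filter_upwards [ae_lt_top (Measurable.tsum hmeas) htot] with x hx
    have hs : Summable fun j => ‖x j‖ ^ p.toReal := by
      have := ENNReal.summable_toReal hx.ne
      simpa [← ENNReal.toReal_rpow] using this
    exact ⟨⟨x, memℓp_gen hs⟩, rfl⟩
  rw [diagonalGaussian, (SeqSpace.measurableEmbedding_incl p hp).map_comap,
    Measure.restrict_eq_self_of_ae_mem hae]

end

/-! The balls are compared under a weighted measure `exp F • μ`. If, along every coordinate axis,
its density is even and decreases away from the origin, then moving one coordinate of the centre of
an `ℓ^p` ball to `0` does not decrease its mass: by Fubini the section of the ball is an interval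
whose radius does not depend on that coordinate of the centre. Doing this for all coordinates gives
`setLIntegral_ball_le_centred`. If `F ≥ A` on `B_δ(z)` and `F ≤ B` on `B_δ(0)`, the ratio is thus at
most `exp (B - A)` (`ballRatio_le_exp`).

It remains to find a weight `F = c G ∘ P_k`, with `G` close to `‖·‖ ^ α`, whose growth in each
coordinate is absorbed by the Gaussian factor. For `p ≥ 2`, `G = ‖·‖²` works by Minkowski's
inequality. For `p < 2`, `|t| ^ p` grows faster than `t²` near `0`, so it is smoothed to `(γ² σ_i² +
t²) ^ (p/2)`; the smoothing costs at most `γ ^ p S ^ p` in the sum. -/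

noncomputable section

/-! ### One-dimensional rearrangement. -/

/-- The centred interval of given radius maximises the integral of an even weight that decreases
away from the origin. -/
theorem setLIntegral_ball_le_ball_zero {h : ℝ → ℝ≥0∞}
    (hh : ∀ s t, |s| ≤ |t| → h t ≤ h s) (a r : ℝ) :
    ∫⁻ t in Metric.ball a r, h t ≤ ∫⁻ t in Metric.ball 0 r, h t := by
  have hA : MeasurableSet (Metric.ball a r) := measurableSet_ball
  have hB : MeasurableSet (Metric.ball (0 : ℝ) r) := measurableSet_ball
  rw [← lintegral_inter_add_sdiff h (Metric.ball a r) hB,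
    ← lintegral_inter_add_sdiff h (Metric.ball 0 r) hA, Set.inter_comm]
  refine add_le_add le_rfl ?_
  have hvol : volume (Metric.ball a r \ Metric.ball 0 r)
      = volume (Metric.ball 0 r \ Metric.ball a r) := by
    have h1 := measure_sdiff_add_inter (μ := volume) (Metric.ball a r) hB
    have h2 := measure_sdiff_add_inter (μ := volume) (Metric.ball 0 r) hA
    rw [Real.volume_ball, ← Real.volume_ball a r, ← h1, Set.inter_comm] at h2
    refine ((ENNReal.add_left_inj ?_).1 h2).symm
    exact ne_top_of_le_ne_top measure_ball_lt_top.ne (measure_mono Set.inter_subset_left)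
  -- The differences have equal length, and the value `h r` separates `h` outside the centred
  -- interval from `h` inside it.
  calc ∫⁻ t in Metric.ball a r \ Metric.ball 0 r, h t
      ≤ ∫⁻ _ in Metric.ball a r \ Metric.ball 0 r, h r := by
        refine setLIntegral_mono' (hA.diff hB) fun t ht => hh _ _ ?_
        have h1 : ¬ |t| < r := by simpa using ht.2
        have h2 : 0 < r := Metric.pos_of_mem_ball ht.1
        rw [abs_of_pos h2]
        exact not_lt.1 h1
    _ = ∫⁻ _ in Metric.ball 0 r \ Metric.ball a r, h r := by
        rw [setLIntegral_const, setLIntegral_const, hvol]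
    _ ≤ ∫⁻ t in Metric.ball 0 r \ Metric.ball a r, h t := by
        refine setLIntegral_mono' (hB.diff hA) fun t ht => hh _ _ ?_
        have h1 : |t| < r := by simpa using ht.1
        exact h1.le.trans (le_abs_self r)

/-! ### Replacing a coordinate, and sections of `ℓ^p` balls. -/

namespace SeqSpace

variable {p : ℝ≥0∞}

/-- Replace the `j`-th coordinate of a sequence by `t`. -/
def setCoord (j : ℕ) (x : SeqSpace p) (t : ℝ) : SeqSpace p := x + lp.single p j (t - x j)

theorem setCoord_apply (j : ℕ) (x : SeqSpace p) (t : ℝ) (i : ℕ) :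
    setCoord j x t i = if i = j then t else x i := by
  rcases eq_or_ne i j with rfl | h
  · simp [setCoord]
  · simp [setCoord, h]

theorem incl_setCoord (j : ℕ) (x : SeqSpace p) (t : ℝ) :
    incl p (setCoord j x t) = Function.update (incl p x) j t := by
  funext i
  simp [incl, setCoord_apply, Function.update_apply]

theorem setCoord_sub_sum_single (n : ℕ) (z : SeqSpace p) :
    setCoord n (z - ∑ i ∈ Finset.range n, lp.single p i (z i)) 0
      = z - ∑ i ∈ Finset.range (n + 1), lp.single p i (z i) := by
  have h : (∑ i ∈ Finset.range n, (lp.single p i (z i) : SeqSpace p) : SeqSpace p) n = 0 := by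
    rw [lp.coeFn_sum, Finset.sum_apply]
    refine Finset.sum_eq_zero fun i hi => ?_
    rw [lp.single_apply, Pi.single_eq_of_ne (Finset.mem_range.1 hi).ne']
  rw [setCoord, Finset.sum_range_succ, lp.coeFn_sub, Pi.sub_apply, h, sub_zero, zero_sub,
    lp.single_neg]
  abel

theorem toReal_pos [Fact (1 ≤ p)] (hp : p ≠ ∞) : 0 < p.toReal :=
  ENNReal.toReal_pos (zero_lt_one.trans_le (Fact.out : (1 : ℝ≥0∞) ≤ p)).ne' hp

theorem norm_rpow [Fact (1 ≤ p)] (hp : p ≠ ∞) (x : SeqSpace p) :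
    ‖x‖ ^ p.toReal = ∑' i, |x i| ^ p.toReal :=
  lp.norm_rpow_eq_tsum (toReal_pos hp) x

theorem summable_rpow [Fact (1 ≤ p)] (hp : p ≠ ∞) (x : SeqSpace p) :
    Summable fun i => |x i| ^ p.toReal :=
  (lp.memℓp x).summable (toReal_pos hp)

theorem norm_rpow_setCoord_sub [Fact (1 ≤ p)] (hp : p ≠ ∞) (j : ℕ) (x w : SeqSpace p) (t : ℝ) :
    ‖setCoord j x t - w‖ ^ p.toReal
      = |t - w j| ^ p.toReal + ∑' i, if i = j then 0 else |x i - w i| ^ p.toReal := by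
  rw [norm_rpow hp, (summable_rpow hp _).tsum_eq_add_tsum_ite j]
  congr 1
  · simp [setCoord_apply]
  · refine tsum_congr fun i => ?_
    split_ifs with h
    · rfl
    · simp [setCoord_apply, h]

/-- The sections of a ball in direction `j` are intervals centred at the `j`-th coordinate of the
centre, and their radius does not depend on that coordinate. -/
theorem exists_setCoord_mem_ball_iff [Fact (1 ≤ p)] (hp : p ≠ ∞) (j : ℕ) (x z : SeqSpace p)
    {δ : ℝ} (hδ : 0 < δ) :
    ∃ r, ∀ t a, setCoord j x t ∈ Metric.ball (setCoord j z a) δ ↔ t ∈ Metric.ball a r := by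
  have hp0 := toReal_pos hp
  set R := ∑' i, if i = j then 0 else |x i - z i| ^ p.toReal with hR
  have key : ∀ t a, setCoord j x t ∈ Metric.ball (setCoord j z a) δ ↔
      |t - a| ^ p.toReal < δ ^ p.toReal - R := by
    intro t a
    rw [Metric.mem_ball, dist_eq_norm, ← Real.rpow_lt_rpow_iff (norm_nonneg _) hδ.le hp0,
      norm_rpow_setCoord_sub hp, setCoord_apply, if_pos rfl, lt_sub_iff_add_lt]
    have : (∑' i, if i = j then 0 else |x i - setCoord j z a i| ^ p.toReal) = R := by
      refine tsum_congr fun i => ?_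
      split_ifs with h
      · rfl
      · simp [setCoord_apply, h]
    rw [this]
  rcases le_or_gt (δ ^ p.toReal - R) 0 with h | h
  -- The other coordinates already use up the radius: the section is empty, as is a ball of radius
  -- `0`.
  · refine ⟨0, fun t a => ?_⟩
    rw [key, Metric.ball_zero]
    simpa using h.trans (by positivity)
  · refine ⟨(δ ^ p.toReal - R) ^ p.toReal⁻¹, fun t a => ?_⟩
    rw [key, Metric.mem_ball, Real.dist_eq,
      Real.lt_rpow_inv_iff_of_pos (abs_nonneg _) h.le hp0]

theorem continuous_eval [Fact (1 ≤ p)] (j : ℕ) : Continuous fun x : SeqSpace p => x j := by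
  have h0 : p ≠ 0 := (zero_lt_one.trans_le (Fact.out : (1 : ℝ≥0∞) ≤ p)).ne'
  refine (LipschitzWith.of_dist_le_mul (K := 1) fun x y => ?_).continuous
  have := lp.norm_apply_le_norm h0 (x - y) j
  simpa [dist_eq_norm] using this

theorem measurable_eval [Fact (1 ≤ p)] (j : ℕ) : Measurable fun x : SeqSpace p => x j :=
  (continuous_eval j).measurable

theorem measurable_setCoord [Fact (1 ≤ p)] (hp : p ≠ ∞) (j : ℕ) :
    Measurable fun y : SeqSpace p × ℝ => setCoord j y.1 y.2 := by
  refine ((measurableEmbedding_incl p hp).measurable_comp_iff).1 ?_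
  refine measurable_pi_lambda _ fun i => ?_
  have : (fun y : SeqSpace p × ℝ => (incl p ∘ fun y : SeqSpace p × ℝ => setCoord j y.1 y.2) y i)
      = fun y => if i = j then y.2 else y.1 i := by
    funext y
    exact setCoord_apply j y.1 y.2 i
  rw [this]
  split_ifs
  · exact measurable_snd
  · exact (measurable_eval i).comp measurable_fst

end SeqSpace

/-- Coordinate `j` is independent of the others, so overwriting it by an independent copy preserves
the law. This gives Fubini in direction `j` without splitting the sequence space into factors. -/
theorem map_update_infinitePi_prod (ν : ℕ → Measure ℝ) [∀ i, IsProbabilityMeasure (ν i)] (j : ℕ) :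
    ((Measure.infinitePi ν).prod (ν j)).map (fun y => Function.update y.1 j y.2)
      = Measure.infinitePi ν := by
  have hm : Measurable fun y : (ℕ → ℝ) × ℝ => Function.update y.1 j y.2 := by fun_prop
  refine Measure.eq_infinitePi ν fun s T hT => ?_
  have hpre : (fun y : (ℕ → ℝ) × ℝ => Function.update y.1 j y.2) ⁻¹' ((s : Set ℕ).pi T)
      = (((s.erase j : Finset ℕ) : Set ℕ).pi T) ×ˢ (if j ∈ s then T j else Set.univ) := by
    ext y
    simp only [Set.mem_preimage, Set.mem_pi, Set.mem_prod, Finset.mem_coe, Finset.mem_erase]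
    constructor
    · intro h
      refine ⟨fun i hi => by simpa [hi.1] using h i hi.2, ?_⟩
      split_ifs with hj
      · simpa using h j hj
      · trivial
    · rintro ⟨h1, h2⟩ i hi
      rcases eq_or_ne i j with rfl | hij
      · simpa [hi] using h2
      · simpa [hij] using h1 i ⟨hij, hi⟩
  rw [Measure.map_apply hm (MeasurableSet.pi s.countable_toSet fun i _ => hT i), hpre,
    Measure.prod_prod, Measure.infinitePi_pi ν fun i _ => hT i]
  split_ifs with hj
  · exact Finset.prod_erase_mul s _ hj
  · simp [Finset.erase_eq_of_notMem hj]

/-! ### Anderson's inequality for weighted Gaussian measures on `ℓ^p`. -/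

section

variable {p : ℝ≥0∞} {σ : ℕ → ℝ}

/-- Weights `exp F` for which the density of `exp F • μ` along every coordinate axis is even and
decreases away from the origin. -/
def CoordinatewiseUnimodal (σ : ℕ → ℝ) (F : SeqSpace p → ℝ) : Prop :=
  ∀ (j : ℕ) (x : SeqSpace p) (s t : ℝ), |s| ≤ |t| →
    F (SeqSpace.setCoord j x t) - F (SeqSpace.setCoord j x s) ≤ (t ^ 2 - s ^ 2) / (2 * σ j ^ 2)

theorem coordinatewiseUnimodal_zero (hpos : ∀ j, 0 < σ j) :
    CoordinatewiseUnimodal σ (fun _ : SeqSpace p => (0 : ℝ)) := by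
  intro j x s t hst
  have := hpos j
  have h2 := sq_le_sq.2 hst
  rw [sub_self]
  exact div_nonneg (sub_nonneg.2 h2) (by positivity)

/-- The growth of `F` permitted by `CoordinatewiseUnimodal` is exactly what the Gaussian exponent
`-t² / (2 σ_j²)` loses. -/
theorem CoordinatewiseUnimodal.gaussianPDF_mul_le {F : SeqSpace p → ℝ}
    (hF : CoordinatewiseUnimodal σ F) (hpos : ∀ j, 0 < σ j) (j : ℕ) (x : SeqSpace p)
    {s t : ℝ} (hst : |s| ≤ |t|) :
    gaussianPDF 0 (Real.toNNReal (σ j ^ 2)) t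
        * ENNReal.ofReal (Real.exp (F (SeqSpace.setCoord j x t)))
      ≤ gaussianPDF 0 (Real.toNNReal (σ j ^ 2)) s
        * ENNReal.ofReal (Real.exp (F (SeqSpace.setCoord j x s))) := by
  have hσ := hpos j
  rw [gaussianPDF, gaussianPDF, ← ENNReal.ofReal_mul (gaussianPDFReal_nonneg _ _ _),
    ← ENNReal.ofReal_mul (gaussianPDFReal_nonneg _ _ _)]
  refine ENNReal.ofReal_le_ofReal ?_
  simp only [gaussianPDFReal]
  rw [mul_assoc, mul_assoc _ (Real.exp _), ← Real.exp_add, ← Real.exp_add,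
    Real.coe_toNNReal _ (sq_nonneg _)]
  refine mul_le_mul_of_nonneg_left (Real.exp_le_exp.2 ?_) (by positivity)
  have := hF j x s t hst
  rw [sub_div] at this
  simp only [sub_zero, neg_div]
  linarith

variable [Fact (1 ≤ p)]

theorem isProbabilityMeasure_diagonalGaussian (hp : p ≠ ∞)
    (hpos : ∀ j, 0 < σ j) (hsum : Summable fun j => σ j ^ p.toReal) :
    IsProbabilityMeasure (diagonalGaussian p σ) := by
  refine ⟨?_⟩
  have h := map_incl_diagonalGaussian p hp σ hpos hsum
  have h2 := congrArg (fun ν => ν Set.univ) h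
  simp only [Measure.map_apply (SeqSpace.measurableEmbedding_incl p hp).measurable
    MeasurableSet.univ, Set.preimage_univ] at h2
  rw [h2, gaussianProduct, measure_univ]

theorem map_setCoord_diagonalGaussian_prod (hp : p ≠ ∞)
    (hpos : ∀ j, 0 < σ j) (hsum : Summable fun j => σ j ^ p.toReal) (j : ℕ) :
    ((diagonalGaussian p σ).prod (gaussianReal 0 (Real.toNNReal (σ j ^ 2)))).map
      (fun y => SeqSpace.setCoord j y.1 y.2) = diagonalGaussian p σ := by
  have := isProbabilityMeasure_diagonalGaussian hp hpos hsum
  have he := SeqSpace.measurableEmbedding_incl p hp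
  have hincl := map_incl_diagonalGaussian p hp σ hpos hsum
  have hu : Measurable fun y : (ℕ → ℝ) × ℝ => Function.update y.1 j y.2 := by fun_prop
  -- Since `incl` is a measurable embedding, it suffices to compare the images in `ℝ^ℕ`.
  rw [← he.comap_map (Measure.map _ _),
    Measure.map_map he.measurable (SeqSpace.measurable_setCoord hp j)]
  have hc : SeqSpace.incl p ∘ (fun y : SeqSpace p × ℝ => SeqSpace.setCoord j y.1 y.2)
      = (fun y : (ℕ → ℝ) × ℝ => Function.update y.1 j y.2) ∘ Prod.map (SeqSpace.incl p) id := by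
    funext y
    exact SeqSpace.incl_setCoord j y.1 y.2
  rw [hc, ← Measure.map_map hu (he.measurable.prodMap measurable_id),
    ← Measure.map_prod_map _ _ he.measurable measurable_id, hincl, Measure.map_id]
  exact congrArg (Measure.comap _) (map_update_infinitePi_prod _ j)

theorem lintegral_diagonalGaussian_setCoord (hp : p ≠ ∞)
    (hpos : ∀ j, 0 < σ j) (hsum : Summable fun j => σ j ^ p.toReal) (j : ℕ)
    {f : SeqSpace p → ℝ≥0∞} (hf : Measurable f) :
    ∫⁻ x, f x ∂(diagonalGaussian p σ) = ∫⁻ x, (∫⁻ t,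
      gaussianPDF 0 (Real.toNNReal (σ j ^ 2)) t * f (SeqSpace.setCoord j x t))
        ∂(diagonalGaussian p σ) := by
  have := isProbabilityMeasure_diagonalGaussian hp hpos hsum
  have hm := SeqSpace.measurable_setCoord hp j
  have hv : Real.toNNReal (σ j ^ 2) ≠ 0 := by simpa using (hpos j).ne'
  conv_lhs => rw [← map_setCoord_diagonalGaussian_prod hp hpos hsum j]
  rw [lintegral_map hf hm, lintegral_prod (fun y => f (SeqSpace.setCoord j y.1 y.2))
    (hf.comp hm).aemeasurable]
  refine lintegral_congr fun x => ?_
  rw [gaussianReal_of_var_ne_zero _ hv]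
  exact lintegral_withDensity_eq_lintegral_mul _ (measurable_gaussianPDF _ _)
    (hf.comp (hm.comp measurable_prodMk_left))

theorem setLIntegral_ball_le_setCoord (hp : p ≠ ∞)
    (hpos : ∀ j, 0 < σ j) (hsum : Summable fun j => σ j ^ p.toReal)
    {F : SeqSpace p → ℝ} (hFm : Measurable F) (hF : CoordinatewiseUnimodal σ F)
    (j : ℕ) (z : SeqSpace p) (δ : ℝ) :
    ∫⁻ x in Metric.ball z δ, ENNReal.ofReal (Real.exp (F x)) ∂(diagonalGaussian p σ)
      ≤ ∫⁻ x in Metric.ball (SeqSpace.setCoord j z 0) δ,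
          ENNReal.ofReal (Real.exp (F x)) ∂(diagonalGaussian p σ) := by
  rcases le_or_gt δ 0 with hδ | hδ
  · simp [Metric.ball_eq_empty.2 hδ]
  have hW : Measurable fun x => ENNReal.ofReal (Real.exp (F x)) := hFm.exp.ennreal_ofReal
  have hz : SeqSpace.setCoord j z (z j) = z := by simp [SeqSpace.setCoord]
  rw [← lintegral_indicator measurableSet_ball, ← lintegral_indicator measurableSet_ball,
    lintegral_diagonalGaussian_setCoord hp hpos hsum j (hW.indicator measurableSet_ball),
    lintegral_diagonalGaussian_setCoord hp hpos hsum j (hW.indicator measurableSet_ball)]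
  refine lintegral_mono fun x => ?_
  obtain ⟨r, hr⟩ := SeqSpace.exists_setCoord_mem_ball_iff hp j x z hδ
  have key : ∀ a, ∫⁻ t, gaussianPDF 0 (Real.toNNReal (σ j ^ 2)) t *
      (Metric.ball (SeqSpace.setCoord j z a) δ).indicator
        (fun x => ENNReal.ofReal (Real.exp (F x))) (SeqSpace.setCoord j x t)
      = ∫⁻ t in Metric.ball a r, gaussianPDF 0 (Real.toNNReal (σ j ^ 2)) t
        * ENNReal.ofReal (Real.exp (F (SeqSpace.setCoord j x t))) := by
    intro a
    rw [← lintegral_indicator measurableSet_ball]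
    refine lintegral_congr fun t => ?_
    by_cases ht : t ∈ Metric.ball a r
    · rw [Set.indicator_of_mem ht, Set.indicator_of_mem ((hr t a).2 ht)]
    · rw [Set.indicator_of_notMem ht, Set.indicator_of_notMem (fun h => ht ((hr t a).1 h)),
        mul_zero]
  have h1 := key (z j)
  rw [hz] at h1
  rw [h1, key 0]
  exact setLIntegral_ball_le_ball_zero (fun s t hst => hF.gaussianPDF_mul_le hpos j x hst) _ _

theorem setLIntegral_ball_le_sub_sum_single (hp : p ≠ ∞)
    (hpos : ∀ j, 0 < σ j) (hsum : Summable fun j => σ j ^ p.toReal)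
    {F : SeqSpace p → ℝ} (hFm : Measurable F) (hF : CoordinatewiseUnimodal σ F)
    (z : SeqSpace p) (δ : ℝ) (n : ℕ) :
    ∫⁻ x in Metric.ball z δ, ENNReal.ofReal (Real.exp (F x)) ∂(diagonalGaussian p σ)
      ≤ ∫⁻ x in Metric.ball (z - ∑ i ∈ Finset.range n, lp.single p i (z i)) δ,
          ENNReal.ofReal (Real.exp (F x)) ∂(diagonalGaussian p σ) := by
  induction n with
  | zero => simp
  | succ n ih =>
    rw [← SeqSpace.setCoord_sub_sum_single]
    exact ih.trans (setLIntegral_ball_le_setCoord hp hpos hsum hFm hF n _ δ)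

/-- Anderson's inequality for balls of `ℓ^p` and the measure `exp F • μ`. -/
theorem setLIntegral_ball_le_centred (hp : p ≠ ∞)
    (hpos : ∀ j, 0 < σ j) (hsum : Summable fun j => σ j ^ p.toReal)
    {F : SeqSpace p → ℝ} (hFm : Measurable F) (hF : CoordinatewiseUnimodal σ F)
    (z : SeqSpace p) (δ : ℝ) :
    ∫⁻ x in Metric.ball z δ, ENNReal.ofReal (Real.exp (F x)) ∂(diagonalGaussian p σ)
      ≤ ∫⁻ x in Metric.ball 0 δ, ENNReal.ofReal (Real.exp (F x)) ∂(diagonalGaussian p σ) := by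
  set ν := (diagonalGaussian p σ).withDensity fun x => ENNReal.ofReal (Real.exp (F x)) with hν
  have hν_apply : ∀ w r, ∫⁻ x in Metric.ball w r, ENNReal.ofReal (Real.exp (F x))
      ∂(diagonalGaussian p σ) = ν (Metric.ball w r) := fun w r =>
    (withDensity_apply _ measurableSet_ball).symm
  -- The centres with the first `n` coordinates zeroed tend to `0`, but the mass of a ball need not
  -- vary continuously with its centre. A smaller radius leaves room for the inclusion in the
  -- centred ball; continuity from below then restores the radius `δ`.
  have hsmall : ∀ r < δ, ν (Metric.ball z r) ≤ ν (Metric.ball 0 δ) := by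
    intro r hr
    have hlim : Filter.Tendsto (fun n => ‖z - ∑ i ∈ Finset.range n, lp.single p i (z i)‖)
        Filter.atTop (nhds 0) := by
      have h := (lp.hasSum_single hp z).tendsto_sum_nat
      have h2 := (tendsto_const_nhds (x := z)).sub h
      simpa using h2.norm
    obtain ⟨n, hn⟩ := (hlim.eventually_lt_const (sub_pos.2 hr)).exists
    have h := setLIntegral_ball_le_sub_sum_single hp hpos hsum hFm hF z r n
    rw [hν_apply, hν_apply] at h
    refine h.trans (measure_mono (Metric.ball_subset_ball' ?_))
    rw [dist_zero_right]
    linarith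
  rw [hν_apply, hν_apply]
  have hU : Metric.ball z δ = ⋃ n : ℕ, Metric.ball z (δ - 1 / ((n : ℝ) + 1)) := by
    ext x
    simp only [Metric.mem_ball, Set.mem_iUnion]
    constructor
    · intro h
      obtain ⟨n, hn⟩ := exists_nat_one_div_lt (sub_pos.2 h)
      exact ⟨n, by linarith⟩
    · rintro ⟨n, hn⟩
      have : (0 : ℝ) < 1 / ((n : ℝ) + 1) := by positivity
      linarith
  have hmono : Monotone fun n : ℕ => Metric.ball z (δ - 1 / ((n : ℝ) + 1)) := by
    intro m n hmn
    refine Metric.ball_subset_ball ?_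
    gcongr
  rw [hU, hmono.measure_iUnion]
  refine iSup_le fun n => hsmall _ ?_
  have : (0 : ℝ) < 1 / ((n : ℝ) + 1) := by positivity
  linarith

theorem diagonalGaussian_ball_le_centred (hp : p ≠ ∞)
    (hpos : ∀ j, 0 < σ j) (hsum : Summable fun j => σ j ^ p.toReal) (z : SeqSpace p) (δ : ℝ) :
    diagonalGaussian p σ (Metric.ball z δ) ≤ diagonalGaussian p σ (Metric.ball 0 δ) := by
  simpa using setLIntegral_ball_le_centred hp hpos hsum measurable_const
    (coordinatewiseUnimodal_zero hpos) z δ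

/-- If the centred ball were null, Anderson's inequality would make every ball of radius `δ` null,
yet countably many of them cover the separable space. -/
theorem diagonalGaussian_ball_zero_pos (hp : p ≠ ∞)
    (hpos : ∀ j, 0 < σ j) (hsum : Summable fun j => σ j ^ p.toReal) {δ : ℝ} (hδ : 0 < δ) :
    0 < diagonalGaussian p σ (Metric.ball 0 δ) := by
  have := isProbabilityMeasure_diagonalGaussian hp hpos hsum
  have := SeqSpace.secondCountable p hp
  by_contra h
  have h0 : diagonalGaussian p σ (Metric.ball 0 δ) = 0 := by simpa using h
  have hcov : (⋃ n, Metric.ball (TopologicalSpace.denseSeq (SeqSpace p) n) δ) = Set.univ :=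
    Set.eq_univ_of_forall fun x => by
      obtain ⟨n, hn⟩ := (TopologicalSpace.denseRange_denseSeq (SeqSpace p)).exists_dist_lt x hδ
      exact Set.mem_iUnion.2 ⟨n, hn⟩
  have hz : diagonalGaussian p σ (⋃ n, Metric.ball (TopologicalSpace.denseSeq (SeqSpace p) n) δ)
      = 0 := measure_iUnion_null fun n => le_antisymm
        ((diagonalGaussian_ball_le_centred hp hpos hsum _ δ).trans h0.le) (zero_le)
  rw [hcov, measure_univ] at hz
  exact one_ne_zero hz

/-- Comparison of the masses of two balls by means of bounds on the weight. -/
theorem ballRatio_le_exp (hp : p ≠ ∞)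
    (hpos : ∀ j, 0 < σ j) (hsum : Summable fun j => σ j ^ p.toReal)
    {F : SeqSpace p → ℝ} (hFm : Measurable F) (hF : CoordinatewiseUnimodal σ F)
    {z : SeqSpace p} {δ A B : ℝ} (hδ : 0 < δ) (hA : ∀ x ∈ Metric.ball z δ, A ≤ F x)
    (hB : ∀ x ∈ Metric.ball 0 δ, F x ≤ B) :
    ballRatio (diagonalGaussian p σ) z 0 δ ≤ Real.exp (B - A) := by
  have := isProbabilityMeasure_diagonalGaussian hp hpos hsum
  have hpos0 : 0 < (diagonalGaussian p σ).real (Metric.ball 0 δ) :=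
    ENNReal.toReal_pos (diagonalGaussian_ball_zero_pos hp hpos hsum hδ).ne' (measure_ne_top _ _)
  rw [ballRatio, div_le_iff₀ hpos0, Real.exp_sub, div_mul_eq_mul_div,
    le_div_iff₀ (Real.exp_pos A), mul_comm]
  have h : ENNReal.ofReal (Real.exp A) * diagonalGaussian p σ (Metric.ball z δ)
      ≤ ENNReal.ofReal (Real.exp B) * diagonalGaussian p σ (Metric.ball 0 δ) := by
    rw [← setLIntegral_const, ← setLIntegral_const]
    refine le_trans ?_ ((setLIntegral_ball_le_centred hp hpos hsum hFm hF z δ).trans ?_)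
    · refine setLIntegral_mono' measurableSet_ball fun x hx => ?_
      gcongr
      exact hA x hx
    · refine setLIntegral_mono' measurableSet_ball fun x hx => ?_
      gcongr
      exact hB x hx
  have h2 := ENNReal.toReal_mono (ENNReal.mul_ne_top (by simp) (measure_ne_top _ _)) h
  rwa [ENNReal.toReal_mul, ENNReal.toReal_mul, ENNReal.toReal_ofReal (Real.exp_pos _).le,
    ENNReal.toReal_ofReal (Real.exp_pos _).le] at h2

end

/-! ### Growth of powers and norms along a coordinate axis. -/

/-- Concavity: Bernoulli's inequality puts the power below its tangent at `u`, whose slope is at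
most the one at `u₀`. -/
theorem Real.rpow_sub_rpow_le_of_le_one {r u₀ u v : ℝ} (hr0 : 0 ≤ r) (hr1 : r ≤ 1)
    (hu₀ : 0 < u₀) (hu : u₀ ≤ u) (huv : u ≤ v) :
    v ^ r - u ^ r ≤ r * u₀ ^ (r - 1) * (v - u) := by
  have hup : 0 < u := hu₀.trans_le hu
  have h1 : -1 ≤ (v - u) / u := by
    have : 0 ≤ (v - u) / u := div_nonneg (by linarith) hup.le
    linarith
  have h2 := rpow_one_add_le_one_add_mul_self h1 hr0 hr1
  have hv : v = u * (1 + (v - u) / u) := by field_simp; ring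
  have h3 : v ^ r ≤ u ^ r + r * u ^ (r - 1) * (v - u) := by
    calc v ^ r = u ^ r * (1 + (v - u) / u) ^ r := by
          conv_lhs => rw [hv]
          exact Real.mul_rpow hup.le (by linarith)
      _ ≤ u ^ r * (1 + r * ((v - u) / u)) := by gcongr
      _ = u ^ r + r * u ^ (r - 1) * (v - u) := by
          rw [Real.rpow_sub_one hup.ne']
          field_simp
  have h4 : u ^ (r - 1) ≤ u₀ ^ (r - 1) :=
    Real.rpow_le_rpow_of_nonpos hu₀ hu (by linarith)
  have h5 : r * u ^ (r - 1) * (v - u) ≤ r * u₀ ^ (r - 1) * (v - u) := by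
    have : 0 ≤ v - u := by linarith
    gcongr
  linarith

/-- Minkowski's inequality in the plane with one degenerate summand. -/
theorem Real.rpow_add_rpow_inv_sub_le {m B u v : ℝ} (hm : 1 ≤ m) (hB : 0 ≤ B) (hu : 0 ≤ u)
    (huv : u ≤ v) :
    (v ^ m + B) ^ (1 / m) - (u ^ m + B) ^ (1 / m) ≤ v - u := by
  have hm0 : 0 < m := by linarith
  have h := Real.Lp_add_le Finset.univ ![u, B ^ (1 / m)] ![v - u, 0] hm
  have hB' : (B ^ (1 / m)) ^ m = B := by
    rw [← Real.rpow_mul hB, one_div_mul_cancel hm0.ne', Real.rpow_one]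
  have h1 : ((v - u) ^ m) ^ m⁻¹ = v - u := Real.rpow_rpow_inv (by linarith) hm0.ne'
  simp [Fin.sum_univ_two, abs_of_nonneg hu, abs_of_nonneg (sub_nonneg.2 huv),
    abs_of_nonneg (hu.trans huv), abs_of_nonneg (Real.rpow_nonneg hB _), hm0.ne'] at h
  simp only [one_div] at h hB' ⊢
  rw [hB', h1] at h
  linarith

namespace SeqSpace

variable {p : ℝ≥0∞} [Fact (1 ≤ p)]

theorem tail_apply (k : ℕ) (x : SeqSpace p) (i : ℕ) : tail k x i = x (k + i) := rfl

theorem tail_setCoord_of_lt {j k : ℕ} (h : j < k) (x : SeqSpace p) (t : ℝ) :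
    tail k (setCoord j x t) = tail k x := by
  ext i
  rw [tail_apply, tail_apply, setCoord_apply, if_neg (by omega)]

theorem tail_setCoord_add (k i : ℕ) (x : SeqSpace p) (t : ℝ) :
    tail k (setCoord (k + i) x t) = setCoord i (tail k x) t := by
  ext l
  simp [tail_apply, setCoord_apply]

theorem tail_sub (k : ℕ) (x y : SeqSpace p) : tail k (x - y) = tail k x - tail k y := by
  ext i
  simp [tail_apply]

theorem norm_tail_le (hp : p ≠ ∞) (k : ℕ) (x : SeqSpace p) : ‖tail k x‖ ≤ ‖x‖ := by
  rw [← Real.rpow_le_rpow_iff (norm_nonneg _) (norm_nonneg _) (toReal_pos hp), norm_rpow hp,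
    norm_rpow hp]
  exact (summable_rpow hp (tail k x)).tsum_le_tsum_of_inj (fun i => k + i)
    (add_right_injective k) (fun _ _ => by positivity) (fun _ => le_rfl) (summable_rpow hp x)

theorem measurable_tail (hp : p ≠ ∞) (k : ℕ) : Measurable (tail k : SeqSpace p → SeqSpace p) := by
  refine (LipschitzWith.of_dist_le_mul (K := 1) fun x y => ?_).continuous.measurable
  rw [dist_eq_norm, dist_eq_norm, ← tail_sub]
  simpa using norm_tail_le hp k (x - y)

/-- For `p ≥ 2` the squared norm grows along a coordinate axis at most as the squared
coordinate. -/
theorem sq_norm_setCoord_sub_le (hp : p ≠ ∞) (h2 : 2 ≤ p.toReal) (j : ℕ) (x : SeqSpace p)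
    {s t : ℝ} (hst : |s| ≤ |t|) :
    ‖setCoord j x t‖ ^ 2 - ‖setCoord j x s‖ ^ 2 ≤ t ^ 2 - s ^ 2 := by
  have hp0 := toReal_pos hp
  set R := ∑' i, if i = j then 0 else |x i| ^ p.toReal with hR
  have hR0 : 0 ≤ R := tsum_nonneg fun i => by split_ifs <;> positivity
  -- As a function of `a²`, the squared norm is a planar `ℓ^m` norm with `m = p/2 ≥ 1`.
  have key : ∀ a, ‖setCoord j x a‖ ^ 2 = ((a ^ 2) ^ (p.toReal / 2) + R) ^ (1 / (p.toReal / 2)) := by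
    intro a
    have h := norm_rpow_setCoord_sub hp j x 0 a
    simp only [sub_zero, lp.coeFn_zero, Pi.zero_apply] at h
    rw [← sq_abs a, ← Real.rpow_natCast |a| 2, ← Real.rpow_mul (abs_nonneg a)]
    rw [show ((2 : ℕ) : ℝ) * (p.toReal / 2) = p.toReal by push_cast; ring, ← h,
      ← Real.rpow_mul (norm_nonneg _), ← Real.rpow_natCast]
    congr 1
    push_cast
    field_simp
  rw [key, key]
  exact Real.rpow_add_rpow_inv_sub_le (by linarith) hR0 (sq_nonneg s) (sq_le_sq.2 hst)

end SeqSpace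

/-! ### Weights depending on the tail. -/

section

variable {p : ℝ≥0∞} [Fact (1 ≤ p)] {σ : ℕ → ℝ}

theorem CoordinatewiseUnimodal.comp_tail {k : ℕ} {G : SeqSpace p → ℝ}
    (hG : CoordinatewiseUnimodal (fun i => σ (k + i)) G) (hpos : ∀ j, 0 < σ j) :
    CoordinatewiseUnimodal σ fun x => G (SeqSpace.tail k x) := by
  intro j x s t hst
  rcases lt_or_ge j k with h | h
  · have := hpos j
    simp only [SeqSpace.tail_setCoord_of_lt h, sub_self]
    exact div_nonneg (sub_nonneg.2 (sq_le_sq.2 hst)) (by positivity)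
  · obtain ⟨i, rfl⟩ := Nat.exists_eq_add_of_le h
    simp only [SeqSpace.tail_setCoord_add]
    exact hG i _ s t hst

theorem ballRatio_le_exp_of_norm_tail (hp : p ≠ ∞)
    (hpos : ∀ j, 0 < σ j) (hsum : Summable fun j => σ j ^ p.toReal) {k : ℕ}
    {G : SeqSpace p → ℝ} (hGm : Measurable G) {c α K : ℝ} (hc : 0 ≤ c) (hα : 0 ≤ α) (hK : 0 ≤ K)
    (hG : CoordinatewiseUnimodal (fun i => σ (k + i)) fun y : SeqSpace p => c * G y)
    (hlb : ∀ y, ‖y‖ ^ α ≤ G y) (hub : ∀ y, G y ≤ K + ‖y‖ ^ α)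
    {δ : ℝ} (hδ : 0 < δ) (z : SeqSpace p) :
    ballRatio (diagonalGaussian p σ) z 0 δ
      ≤ Real.exp (-c * (|‖SeqSpace.tail k z‖ - δ| ^ α - K - δ ^ α)) := by
  rcases le_or_gt δ ‖SeqSpace.tail k z‖ with h | h
  · have hA : ∀ x ∈ Metric.ball z δ, c * (‖SeqSpace.tail k z‖ - δ) ^ α
        ≤ c * G (SeqSpace.tail k x) := by
      intro x hx
      refine mul_le_mul_of_nonneg_left (le_trans ?_ (hlb _)) hc
      refine Real.rpow_le_rpow (sub_nonneg.2 h) ?_ hα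
      have h1 := norm_sub_norm_le (SeqSpace.tail k z) (SeqSpace.tail k x)
      rw [← SeqSpace.tail_sub] at h1
      have h2 := SeqSpace.norm_tail_le hp k (z - x)
      rw [← dist_eq_norm, dist_comm] at h2
      have h3 := Metric.mem_ball.1 hx
      linarith
    have hB : ∀ x ∈ Metric.ball 0 δ, c * G (SeqSpace.tail k x) ≤ c * (K + δ ^ α) := by
      intro x hx
      refine mul_le_mul_of_nonneg_left ((hub _).trans ?_) hc
      have h1 := (SeqSpace.norm_tail_le hp k x).trans (mem_ball_zero_iff.1 hx).le
      gcongr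
    refine (ballRatio_le_exp hp hpos hsum ((hGm.comp (SeqSpace.measurable_tail hp k)).const_mul c)
      (hG.comp_tail hpos) hδ hA hB).trans (Real.exp_le_exp.2 ?_)
    rw [abs_of_nonneg (sub_nonneg.2 h)]
    linarith
  -- Here the claimed exponent is nonnegative, so the bound by `1` from the weight `F = 0` suffices.
  · refine (ballRatio_le_exp hp hpos hsum measurable_const (coordinatewiseUnimodal_zero hpos)
      hδ (A := 0) (B := 0) (fun _ _ => le_rfl) (fun _ _ => le_rfl)).trans
      (Real.exp_le_exp.2 ?_)
    have h1 : |‖SeqSpace.tail k z‖ - δ| ^ α ≤ δ ^ α := by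
      refine Real.rpow_le_rpow (abs_nonneg _) ?_ hα
      rw [abs_le]
      constructor <;> linarith [norm_nonneg (SeqSpace.tail k z)]
    rw [sub_zero, neg_mul, ← mul_neg]
    exact mul_nonneg hc (by linarith)

/-- The regularised `p`-th power of the norm, `∑ᵢ (aᵢ² + yᵢ²)^(p/2)`. -/
def smoothedNorm (p : ℝ≥0∞) (a : ℕ → ℝ) (y : SeqSpace p) : ℝ :=
  ∑' i, (a i ^ 2 + y i ^ 2) ^ (p.toReal / 2)

theorem Real.abs_rpow_eq_sq_rpow (x r : ℝ) : |x| ^ r = (x ^ 2) ^ (r / 2) := by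
  rw [← sq_abs, ← Real.rpow_natCast, ← Real.rpow_mul (abs_nonneg x)]
  congr 1
  push_cast
  ring

theorem smoothedNorm_term_le (hp : p ≠ ∞) (h2 : p.toReal ≤ 2) (a b : ℝ) :
    (a ^ 2 + b ^ 2) ^ (p.toReal / 2) ≤ |a| ^ p.toReal + |b| ^ p.toReal := by
  have hp0 := SeqSpace.toReal_pos hp
  rw [Real.abs_rpow_eq_sq_rpow, Real.abs_rpow_eq_sq_rpow]
  exact Real.rpow_add_le_add_rpow (sq_nonneg _) (sq_nonneg _) (by linarith) (by linarith)

theorem summable_smoothedNorm (hp : p ≠ ∞) (h2 : p.toReal ≤ 2) {a : ℕ → ℝ}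
    (ha : Summable fun i => |a i| ^ p.toReal) (y : SeqSpace p) :
    Summable fun i => (a i ^ 2 + y i ^ 2) ^ (p.toReal / 2) :=
  (ha.add (SeqSpace.summable_rpow hp y)).of_nonneg_of_le (fun _ => by positivity)
    fun i => smoothedNorm_term_le hp h2 (a i) (y i)

theorem norm_rpow_le_smoothedNorm (hp : p ≠ ∞) (h2 : p.toReal ≤ 2) {a : ℕ → ℝ}
    (ha : Summable fun i => |a i| ^ p.toReal) (y : SeqSpace p) :
    ‖y‖ ^ p.toReal ≤ smoothedNorm p a y := by
  have hp0 := SeqSpace.toReal_pos hp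
  rw [SeqSpace.norm_rpow hp]
  refine (SeqSpace.summable_rpow hp y).tsum_le_tsum (fun i => ?_)
    (summable_smoothedNorm hp h2 ha y)
  rw [Real.abs_rpow_eq_sq_rpow]
  gcongr
  linarith [sq_nonneg (a i)]

theorem smoothedNorm_le (hp : p ≠ ∞) (h2 : p.toReal ≤ 2) {a : ℕ → ℝ}
    (ha : Summable fun i => |a i| ^ p.toReal) (y : SeqSpace p) :
    smoothedNorm p a y ≤ ∑' i, |a i| ^ p.toReal + ‖y‖ ^ p.toReal := by
  rw [SeqSpace.norm_rpow hp, ← ha.tsum_add (SeqSpace.summable_rpow hp y)]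
  exact (summable_smoothedNorm hp h2 ha y).tsum_le_tsum
    (fun i => smoothedNorm_term_le hp h2 (a i) (y i)) (ha.add (SeqSpace.summable_rpow hp y))

theorem measurable_smoothedNorm (a : ℕ → ℝ) : Measurable (smoothedNorm p a) :=
  Measurable.tsum fun i =>
    (((SeqSpace.measurable_eval i).pow_const 2).const_add _).pow_const _

theorem smoothedNorm_setCoord_sub_le (hp : p ≠ ∞) (h2 : p.toReal ≤ 2) {a : ℕ → ℝ}
    (ha : Summable fun i => |a i| ^ p.toReal) (hpos : ∀ i, 0 < a i) (j : ℕ) (y : SeqSpace p)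
    {s t : ℝ} (hst : |s| ≤ |t|) :
    smoothedNorm p a (SeqSpace.setCoord j y t) - smoothedNorm p a (SeqSpace.setCoord j y s)
      ≤ p.toReal / 2 * a j ^ (p.toReal - 2) * (t ^ 2 - s ^ 2) := by
  have hp0 := SeqSpace.toReal_pos hp
  have key : ∀ b, smoothedNorm p a (SeqSpace.setCoord j y b)
      = (a j ^ 2 + b ^ 2) ^ (p.toReal / 2)
        + ∑' i, if i = j then 0 else (a i ^ 2 + y i ^ 2) ^ (p.toReal / 2) := by
    intro b
    rw [smoothedNorm, (summable_smoothedNorm hp h2 ha _).tsum_eq_add_tsum_ite j]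
    congr 1
    · simp [SeqSpace.setCoord_apply]
    · refine tsum_congr fun i => ?_
      split_ifs with h
      · rfl
      · simp [SeqSpace.setCoord_apply, h]
  have hj := hpos j
  have h := Real.rpow_sub_rpow_le_of_le_one (r := p.toReal / 2) (u₀ := a j ^ 2)
    (u := a j ^ 2 + s ^ 2) (v := a j ^ 2 + t ^ 2) (by linarith) (by linarith) (by positivity)
    (by linarith [sq_nonneg s]) (by linarith [sq_le_sq.2 hst])
  have ha2 : (a j ^ 2) ^ (p.toReal / 2 - 1) = a j ^ (p.toReal - 2) := by
    rw [show p.toReal / 2 - 1 = (p.toReal - 2) / 2 by ring, ← Real.abs_rpow_eq_sq_rpow,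
      abs_of_pos hj]
  rw [ha2] at h
  rw [key, key]
  linarith

/-- As a function of `t²`, the smoothed term has slope at most `(p/2) (γ σ_j) ^ (p-2)`. With the
factor `c` this must not exceed `1 / (2 σ_j²)`, that is, `c p σ_j ^ p ≤ γ ^ (2-p)`. Smoothing at
scale `γ σ_j` makes this condition monotone in `σ_j`, so an upper bound `M` for all `σ_j` is enough.
-/
theorem coordinatewiseUnimodal_smoothedNorm (hp : p ≠ ∞) (h2 : p.toReal ≤ 2)
    (hpos : ∀ j, 0 < σ j) (hsum : Summable fun j => σ j ^ p.toReal) {γ c M : ℝ} (hγ : 0 < γ)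
    (hM : ∀ j, σ j ≤ M) (hc0 : 0 ≤ c) (hc : c * (p.toReal * M ^ p.toReal) ≤ γ ^ (2 - p.toReal)) :
    CoordinatewiseUnimodal σ fun y : SeqSpace p => c * smoothedNorm p (fun i => γ * σ i) y := by
  have hp0 := SeqSpace.toReal_pos hp
  intro j y s t hst
  have hσ := hpos j
  have ha : Summable fun i => |γ * σ i| ^ p.toReal := by
    simp_rw [abs_mul, Real.mul_rpow (abs_nonneg _) (abs_nonneg _), abs_of_pos (hpos _)]
    exact hsum.mul_left _
  have h := smoothedNorm_setCoord_sub_le hp h2 ha (fun i => mul_pos hγ (hpos i)) j y hst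
  have hts : 0 ≤ t ^ 2 - s ^ 2 := sub_nonneg.2 (sq_le_sq.2 hst)
  have h1 : c * (p.toReal * σ j ^ p.toReal) ≤ γ ^ (2 - p.toReal) := by
    refine le_trans ?_ hc
    have := hM j
    gcongr
  have hinv : γ ^ (2 - p.toReal) * γ ^ (p.toReal - 2) = 1 := by
    rw [← Real.rpow_add hγ]
    simp
  have h3 : c * (p.toReal / 2 * (γ * σ j) ^ (p.toReal - 2)) ≤ 1 / (2 * σ j ^ 2) := by
    rw [Real.mul_rpow hγ.le hσ.le, Real.rpow_sub hσ, Real.rpow_two, le_div_iff₀ (by positivity)]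
    calc c * (p.toReal / 2 * (γ ^ (p.toReal - 2) * (σ j ^ p.toReal / σ j ^ 2))) * (2 * σ j ^ 2)
        = c * (p.toReal * σ j ^ p.toReal) * γ ^ (p.toReal - 2) := by field_simp
      _ ≤ γ ^ (2 - p.toReal) * γ ^ (p.toReal - 2) := by gcongr
      _ = 1 := hinv
  calc c * smoothedNorm p (fun i => γ * σ i) (SeqSpace.setCoord j y t)
        - c * smoothedNorm p (fun i => γ * σ i) (SeqSpace.setCoord j y s)
      ≤ c * (p.toReal / 2 * (γ * σ j) ^ (p.toReal - 2) * (t ^ 2 - s ^ 2)) := by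
        rw [← mul_sub]
        exact mul_le_mul_of_nonneg_left h hc0
    _ = c * (p.toReal / 2 * (γ * σ j) ^ (p.toReal - 2)) * (t ^ 2 - s ^ 2) := by ring
    _ ≤ 1 / (2 * σ j ^ 2) * (t ^ 2 - s ^ 2) := mul_le_mul_of_nonneg_right h3 hts
    _ = (t ^ 2 - s ^ 2) / (2 * σ j ^ 2) := by ring

theorem coordinatewiseUnimodal_sq_norm (hp : p ≠ ∞) (h2 : 2 ≤ p.toReal)
    (hpos : ∀ j, 0 < σ j) {c M : ℝ} (hM : ∀ j, σ j ≤ M) (hc0 : 0 ≤ c) (hc : c * (2 * M ^ 2) ≤ 1) :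
    CoordinatewiseUnimodal σ fun y : SeqSpace p => c * ‖y‖ ^ (2 : ℝ) := by
  intro j y s t hst
  have hσ := hpos j
  have h := SeqSpace.sq_norm_setCoord_sub_le hp h2 j y hst
  have hts : 0 ≤ t ^ 2 - s ^ 2 := sub_nonneg.2 (sq_le_sq.2 hst)
  have h1 : c * (2 * σ j ^ 2) ≤ 1 := by
    refine le_trans ?_ hc
    have := hM j
    gcongr
  simp only [Real.rpow_two]
  rw [← mul_sub, le_div_iff₀ (by positivity)]
  calc c * (‖SeqSpace.setCoord j y t‖ ^ 2 - ‖SeqSpace.setCoord j y s‖ ^ 2) * (2 * σ j ^ 2)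
      ≤ c * (t ^ 2 - s ^ 2) * (2 * σ j ^ 2) := by gcongr
    _ = c * (2 * σ j ^ 2) * (t ^ 2 - s ^ 2) := by ring
    _ ≤ 1 * (t ^ 2 - s ^ 2) := mul_le_mul_of_nonneg_right h1 hts
    _ = t ^ 2 - s ^ 2 := one_mul _

theorem constS_rpow (hp : p ≠ ∞) (hpos : ∀ j, 0 < σ j) :
    constS p σ ^ p.toReal = ∑' j, σ j ^ p.toReal := by
  rw [constS, ← Real.rpow_mul (tsum_nonneg fun j => Real.rpow_nonneg (hpos j).le _),
    one_div_mul_cancel (SeqSpace.toReal_pos hp).ne', Real.rpow_one]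

theorem tsum_abs_mul_rpow_le (hp : p ≠ ∞) (hpos : ∀ j, 0 < σ j)
    (hsum : Summable fun j => σ j ^ p.toReal) {γ : ℝ} (hγ : 0 < γ) (k : ℕ) :
    ∑' i, |γ * σ (k + i)| ^ p.toReal ≤ γ ^ p.toReal * constS p σ ^ p.toReal := by
  have hk : Summable fun i => σ (k + i) ^ p.toReal :=
    hsum.comp_injective (add_right_injective k)
  rw [constS_rpow hp hpos]
  simp_rw [abs_of_pos (mul_pos hγ (hpos _)), Real.mul_rpow hγ.le (hpos _).le]
  rw [tsum_mul_left]
  refine mul_le_mul_of_nonneg_left ?_ (by positivity)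
  exact hk.tsum_le_tsum_of_inj (fun i => k + i) (add_right_injective k)
    (fun j _ => Real.rpow_nonneg (hpos j).le _) (fun _ => le_rfl) hsum

end

end

/-! ### The main theorem: choice of the weight. -/

theorem mainTheorem5 (p : ℝ≥0∞) [Fact (1 ≤ p)] (hp : p ≠ ∞)
    (σ : ℕ → ℝ) (hσ_anti : Antitone σ) (hσ_pos : ∀ j, 0 < σ j)
    (hσ_sum : Summable fun j => σ j ^ p.toReal)
    (δ : ℝ) (hδ_pos : 0 < δ) (hδ_lt : δ < 1) (k : ℕ) (γ : ℝ) (hγ : 0 < γ) (z : SeqSpace p) :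
    0 < (diagonalGaussian p σ).real (Metric.ball 0 δ) ∧
    ballRatio (diagonalGaussian p σ) z 0 δ ≤
      Real.exp (-(γ ^ (2 - expAlpha p) / (4 * constQ p * σ k ^ expAlpha p)) *
        (|‖SeqSpace.tail k z‖ - δ| ^ expAlpha p
          - γ ^ expAlpha p * constS p σ ^ expAlpha p - δ ^ expAlpha p)) := by
  have := isProbabilityMeasure_diagonalGaussian hp hσ_pos hσ_sum
  refine ⟨ENNReal.toReal_pos (diagonalGaussian_ball_zero_pos hp hσ_pos hσ_sum hδ_pos).ne'
    (measure_ne_top _ _), ?_⟩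
  have hp0 := SeqSpace.toReal_pos hp
  have hq : p.toReal ≤ constQ p := le_max_left _ _
  have hq0 : 0 < constQ p := hp0.trans_le hq
  have hσk := hσ_pos k
  -- With indexing from `0`, `σ k` is the `σ_{k+1}` of the statement, the largest deviation seen by
  -- the tail.
  have hM : ∀ i, σ (k + i) ≤ σ k := fun i => hσ_anti (Nat.le_add_right k i)
  have hS : 0 ≤ constS p σ :=
    Real.rpow_nonneg (tsum_nonneg fun j => Real.rpow_nonneg (hσ_pos j).le _) _
  rcases le_total p.toReal 2 with h2 | h2
  · rw [show expAlpha p = p.toReal from min_eq_left h2]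
    have hk : Summable fun i => σ (k + i) ^ p.toReal :=
      hσ_sum.comp_injective (add_right_injective k)
    have ha : Summable fun i => |γ * σ (k + i)| ^ p.toReal := by
      simp_rw [abs_of_pos (mul_pos hγ (hσ_pos _)), Real.mul_rpow hγ.le (hσ_pos _).le]
      exact hk.mul_left _
    refine ballRatio_le_exp_of_norm_tail hp hσ_pos hσ_sum
      (measurable_smoothedNorm fun i => γ * σ (k + i)) (by positivity) hp0.le (by positivity)
      (coordinatewiseUnimodal_smoothedNorm hp h2 (fun i => hσ_pos _) hk hγ hM (by positivity) ?_)
      (norm_rpow_le_smoothedNorm hp h2 ha)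
      (fun y => (smoothedNorm_le hp h2 ha y).trans
        (add_le_add_left (tsum_abs_mul_rpow_le hp hσ_pos hσ_sum hγ k) _)) hδ_pos z
    -- The condition on `c` reduces to `p ≤ 4 q`, which follows from `p ≤ q`.
    rw [div_mul_eq_mul_div, div_le_iff₀ (by positivity)]
    gcongr
    linarith
  · rw [show expAlpha p = 2 from min_eq_right h2]
    refine ballRatio_le_exp_of_norm_tail hp hσ_pos hσ_sum
      (measurable_norm.pow_const (2 : ℝ)) (by positivity) zero_le_two (by positivity)
      (coordinatewiseUnimodal_sq_norm hp h2 (fun i => hσ_pos _) hM (by positivity) ?_)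
      (fun y => le_rfl) (fun y => le_add_of_nonneg_left (by positivity)) hδ_pos z
    -- Here `γ ^ (2-α) = 1`, and the condition reduces to `2 ≤ 4 q`. No smoothing took place, so the
    -- term `γ² S²` is merely a nonnegative surplus.
    rw [sub_self, Real.rpow_zero, Real.rpow_two, div_mul_eq_mul_div, div_le_iff₀ (by positivity)]
    rw [one_mul, one_mul]
    gcongr
    linarith
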